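/- Let $(W,S)$ be a right-angled Coxeter system, i.e. $W = \langle S \mid (st)^{m_{st}} = e\rangle$ with $m_{ss}=1$ and $m_{st}=m_{ts}\in\{2,\infty\}$ for $s\neq t$, and let $|\cdot|$ denote the word length on $W$ with respect to $S$. Let $K$ be an algebraically closed field of characteristic different from $2$, and let $a=(a_s)_{s\in S}$ and $b=(b_s)_{s\in S}$ be families of elements of $K$ such that $b_s\neq -\frac{a_s^2}{4}$ for every $s\in S$. Let $\mathcal H=\mathcal H(W,S,a,b)$ be the generic Hecke algebra, that is, the $K$-algebra which is free as a $K$-module with basis $(T_w)_{w\in W}$ and whose multiplication is determined, for $s\in S$ and $w\in W$, by $$T_sT_w=\begin{cases}T_{sw} & \text{if } |sw|>|w|,\\ a_sT_w+b_sT_{sw} & \text{if } |sw|<|w|.\end{cases}$$ Let $[\mathcal H,\mathcal H]$ be the linear span of all $xy-yx$ with $x,y\in\mathcal H$. Then for every conjugacy class $\mathcal O$ of $W$ the image $T_{\mathcal O}$ of $T_w$ in the cocentre $\mathcal H/[\mathcal H,\mathcal H]$ is the same for all elements $w$ of minimal length in $\mathcal O$, and the family $(T_{\mathcal O})_{\mathcal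 O}$, where $\mathcal O$ runs through the conjugacy classes of $W$, is a basis of the $K$-vector space $\mathcal H/[\mathcal H,\mathcal H]$. -/

import Mathlib

section Exchange

variable {B W : Type*} [Group W] {M : CoxeterMatrix B} (cs : CoxeterSystem M W)

open Classical in
/-- The permutation `(t, ε) ↦ (s t s, ε + [t = s])` of `W × ℤ/2` for `s = s_i`;
used only to prove the exchange property. -/
noncomputable def CoxeterSystem.signedConj (i : B) : Function.End (W × ZMod 2) :=
  fun p => (cs.simple i * p.1 * cs.simple i, p.2 + if p.1 = cs.simple i then 1 else 0)

open Classical in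
theorem CoxeterSystem.signedConj_pow (i j : B) (n : ℕ) (t : W) (e : ZMod 2) :
    ((cs.signedConj i * cs.signedConj j) ^ n) (t, e) =
      ((cs.simple i * cs.simple j) ^ n * t * ((cs.simple i * cs.simple j) ^ n)⁻¹,
        e + ∑ l ∈ Finset.range (2 * n),
          if t = cs.simple j * (cs.simple i * cs.simple j) ^ l then 1 else 0) := by
  set c := cs.simple i * cs.simple j with hc
  have hci : c⁻¹ = cs.simple j * cs.simple i := by simp [hc]
  have hsj : ∀ k : ℕ, cs.simple j * c ^ k = (c ^ k)⁻¹ * cs.simple j := by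
    intro k
    induction k with
    | zero => simp
    | succ k ih =>
      rw [pow_succ, ← mul_assoc, ih, ← pow_succ, pow_succ', mul_inv_rev, mul_assoc, mul_assoc]
      congr 1
      rw [hci, hc]; simp [mul_assoc]
  induction n with
  | zero =>
    simp only [pow_zero, Function.End.one_def, mul_zero, Finset.range_zero, Finset.sum_empty]
    simp
  | succ n ih =>
    have h1 : c ^ n * t * (c ^ n)⁻¹ = cs.simple j ↔ t = cs.simple j * c ^ (2 * n) := by
      rw [two_mul, pow_add, ← mul_assoc, hsj]
      constructor
      · intro h; rw [← h]; group
      · intro h; rw [h]; group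
    have h2 : cs.simple j * (c ^ n * t * (c ^ n)⁻¹) * cs.simple j = cs.simple i ↔
        t = cs.simple j * c ^ (2 * n + 1) := by
      have h3 : cs.simple j * c ^ (2 * n + 1) = (c ^ n)⁻¹ * (cs.simple j * c) * c ^ n := by
        rw [show 2 * n + 1 = n + (1 + n) by ring, pow_add, pow_add, ← mul_assoc, hsj, pow_one]
        group
      rw [h3]
      constructor
      · intro h
        rw [show cs.simple j * c = cs.simple j * cs.simple i * cs.simple j by
          rw [hc, mul_assoc], ← h]
        simp [mul_assoc]
      · intro h
        rw [h, hc]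
        simp [mul_assoc]
    rw [pow_succ']
    change (cs.signedConj i * cs.signedConj j) (((cs.signedConj i * cs.signedConj j) ^ n) (t, e)) = _
    rw [ih]
    change cs.signedConj i (cs.signedConj j _) = _
    simp only [CoxeterSystem.signedConj]
    rw [show 2 * (n + 1) = 2 * n + 1 + 1 by ring, Finset.sum_range_succ, Finset.sum_range_succ]
    refine Prod.ext ?_ ?_
    · change cs.simple i * (cs.simple j * (c ^ n * t * (c ^ n)⁻¹) * cs.simple j) * cs.simple i =
        c ^ (n + 1) * t * (c ^ (n + 1))⁻¹
      rw [pow_succ' c n, mul_inv_rev, hci]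
      generalize (c ^ n)⁻¹ = d
      generalize c ^ n = d'
      simp only [hc, mul_assoc]
    · simp only [h1, h2]
      ring

theorem CoxeterSystem.signedConj_isLiftable : M.IsLiftable cs.signedConj := by
  classical
  intro i j
  funext p
  obtain ⟨t, e⟩ := p
  rw [cs.signedConj_pow, two_mul, Finset.sum_range_add]
  simp only [pow_add, cs.simple_mul_simple_pow, one_mul, mul_one, inv_one]
  rw [CharTwo.add_self_eq_zero, add_zero]
  rfl

open Classical in
theorem CoxeterSystem.lift_signedConj_wordProd (ω : List B) (t : W) (e : ZMod 2) :
    cs.lift ⟨cs.signedConj, cs.signedConj_isLiftable⟩ (cs.wordProd ω) (t, e) =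
      (cs.wordProd ω * t * (cs.wordProd ω)⁻¹, e + ((cs.rightInvSeq ω).count t : ZMod 2)) := by
  induction ω with
  | nil =>
    rw [cs.wordProd_nil, map_one, Function.End.one_def]
    simp
  | cons i ω ih =>
    rw [cs.wordProd_cons, map_mul, cs.lift_apply_simple]
    change cs.signedConj i (cs.lift ⟨cs.signedConj, cs.signedConj_isLiftable⟩
      (cs.wordProd ω) (t, e)) = _
    rw [ih]
    simp only [CoxeterSystem.signedConj]
    have h : cs.wordProd ω * t * (cs.wordProd ω)⁻¹ = cs.simple i ↔
        (cs.wordProd ω)⁻¹ * cs.simple i * cs.wordProd ω = t := by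
      constructor
      · intro h; rw [← h]; group
      · intro h; rw [← h]; group
    refine Prod.ext ?_ ?_
    · simp [mul_assoc]
    · simp only [CoxeterSystem.rightInvSeq, List.count_cons, h, beq_iff_eq]
      push_cast
      ring

/-- Exchange property: a right descent of `π ω` occurs in the right inversion sequence. -/
theorem CoxeterSystem.simple_mem_rightInvSeq {ω : List B} {i : B}
    (h : cs.IsRightDescent (cs.wordProd ω) i) : cs.simple i ∈ cs.rightInvSeq ω := by
  classical
  by_contra hn
  obtain ⟨ω', hω', hw'⟩ := cs.exists_isReduced (cs.wordProd ω * cs.simple i)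
  have h1 := cs.lift_signedConj_wordProd ω' (cs.simple i) 0
  rw [← hw', map_mul, cs.lift_apply_simple] at h1
  change cs.lift ⟨cs.signedConj, cs.signedConj_isLiftable⟩ (cs.wordProd ω)
    (cs.signedConj i (cs.simple i, 0)) = _ at h1
  have h2 : cs.signedConj i (cs.simple i, 0) = (cs.simple i, 1) := by
    simp [CoxeterSystem.signedConj]
  rw [h2, cs.lift_signedConj_wordProd, List.count_eq_zero_of_not_mem hn] at h1
  have h3 := congrArg Prod.snd h1
  have h4 : cs.simple i ∈ cs.rightInvSeq ω' := by
    by_contra hn'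
    rw [List.count_eq_zero_of_not_mem hn'] at h3
    simp at h3
  have h5 := (cs.isRightInversion_of_mem_rightInvSeq hω' h4).2
  rw [← hw'] at h5
  simp only [cs.simple_mul_simple_cancel_right] at h5
  unfold CoxeterSystem.IsRightDescent at h
  omega

/-- If `ℓ (s w) > ℓ w` but `ℓ (s w t) < ℓ (w t)`, then `s w = w t`. -/
theorem CoxeterSystem.simple_mul_eq_mul_simple {w : W} {i j : B}
    (h : ¬ cs.IsLeftDescent w i) (h' : cs.IsLeftDescent (w * cs.simple j) i) :
    cs.simple i * w = w * cs.simple j := by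
  rw [cs.not_isLeftDescent_iff] at h
  rw [cs.isLeftDescent_iff] at h'
  have h1 := cs.length_mul_simple w j
  have h2 := cs.length_mul_simple (cs.simple i * w) j
  rw [← mul_assoc] at h'
  obtain ⟨ω, hω, rfl⟩ := cs.exists_isReduced w
  rw [← cs.wordProd_cons] at *
  have hd : cs.IsRightDescent (cs.wordProd (i :: ω)) j := by
    unfold CoxeterSystem.IsRightDescent; omega
  have hm := cs.simple_mem_rightInvSeq hd
  simp only [CoxeterSystem.rightInvSeq, List.mem_cons] at hm
  rcases hm with hm | hm
  · rw [hm, cs.wordProd_cons]; group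
  · have := (cs.isRightInversion_of_mem_rightInvSeq hω hm).2
    omega

end Exchange

namespace GenericHecke

variable {B W R : Type*} [Group W] [CommRing R] {M : CoxeterMatrix B}

/-- A Coxeter matrix is right-angled if all its entries lie in `{1, 2, ∞}`
(Mathlib encodes the entry `∞` as `0`). -/
def IsRightAngled (M : CoxeterMatrix B) : Prop :=
  ∀ s t : B, M s t = 1 ∨ M s t = 2 ∨ M s t = 0

open Classical in
/-- Left multiplication by `T_s` on the free module with basis `(e_w)_{w ∈ W}`:
`e_w ↦ e_{sw}` if `|sw| > |w|`, and `e_w ↦ a_s e_w + b_s e_{sw}` if `|sw| < |w|`. -/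
noncomputable def leftOp (cs : CoxeterSystem M W) (a b : B → R) (s : B) :
    Module.End R (W →₀ R) :=
  Finsupp.linearCombination R fun w : W =>
    if cs.length w < cs.length (cs.simple s * w) then
      Finsupp.single (cs.simple s * w) (1 : R)
    else
      a s • Finsupp.single w (1 : R) + b s • Finsupp.single (cs.simple s * w) (1 : R)

/-- The generic Hecke algebra `H(W, S, a, b)` over `R`, in its (faithful) left regular
representation: the unital `R`-algebra of endomorphisms of `⨁_w R e_w` generated by the operators
of left multiplication by the `T_s`. By `T_basis` and `T_simple_mul_T` below it is free over `R`
with basis `(T_w)_{w ∈ W}` and its multiplication is given by the defining formula. -/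
noncomputable def heckeAlgebra (cs : CoxeterSystem M W) (a b : B → R) :
    Subalgebra R (Module.End R (W →₀ R)) :=
  Algebra.adjoin R (Set.range (leftOp cs a b))

/-- The ring structure of the Hecke algebra (its semiring structure with `-x = (-1) • x`). -/
noncomputable instance instRingHeckeAlgebra (cs : CoxeterSystem M W) (a b : B → R) :
    Ring (heckeAlgebra cs a b) :=
  Algebra.semiringToRing R

/-- The generator `T_s` of the Hecke algebra. -/
noncomputable def gen (cs : CoxeterSystem M W) (a b : B → R) (s : B) : heckeAlgebra cs a b :=
  ⟨leftOp cs a b s, Algebra.subset_adjoin ⟨s, rfl⟩⟩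

/-- The element `T_w = T_{s_1} ⋯ T_{s_n}` of the Hecke algebra, for a reduced word
`s_1 ⋯ s_n` representing `w` (by `T_eq_of_isReduced` the choice does not matter). -/
noncomputable def T (cs : CoxeterSystem M W) (a b : B → R) (w : W) : heckeAlgebra cs a b :=
  (((cs.exists_isReduced w).choose).map (gen cs a b)).prod

/-- Parameters that agree on generators conjugate in `W`. -/
def ConjInvariant {R : Type*} (cs : CoxeterSystem M W) (a b : B → R) : Prop :=
  ∀ s t : B, IsConj (cs.simple s) (cs.simple t) → a s = a t ∧ b s = b t

section Basis

variable (cs : CoxeterSystem M W) (a b : B → R)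

open Classical in
/-- Right multiplication by `T_s`; used only to show that `(T_w)` is a basis. -/
noncomputable def rightOp (s : B) : Module.End R (W →₀ R) :=
  Finsupp.linearCombination R fun w : W =>
    if cs.length w < cs.length (w * cs.simple s) then
      Finsupp.single (w * cs.simple s) (1 : R)
    else
      a s • Finsupp.single w (1 : R) + b s • Finsupp.single (w * cs.simple s) (1 : R)

theorem leftOp_up {s : B} {w : W} (h : ¬ cs.IsLeftDescent w s) :
    leftOp cs a b s (Finsupp.single w 1) = Finsupp.single (cs.simple s * w) 1 := by
  rw [cs.not_isLeftDescent_iff] at h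
  simp [leftOp, show cs.length w < cs.length (cs.simple s * w) by omega]

theorem leftOp_down {s : B} {w : W} (h : cs.IsLeftDescent w s) :
    leftOp cs a b s (Finsupp.single w 1) =
      a s • Finsupp.single w 1 + b s • Finsupp.single (cs.simple s * w) 1 := by
  rw [cs.isLeftDescent_iff] at h
  simp [leftOp, show ¬ cs.length w < cs.length (cs.simple s * w) by omega]

theorem rightOp_up {s : B} {w : W} (h : ¬ cs.IsRightDescent w s) :
    rightOp cs a b s (Finsupp.single w 1) = Finsupp.single (w * cs.simple s) 1 := by
  rw [cs.not_isRightDescent_iff] at h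
  simp [rightOp, show cs.length w < cs.length (w * cs.simple s) by omega]

theorem rightOp_down {s : B} {w : W} (h : cs.IsRightDescent w s) :
    rightOp cs a b s (Finsupp.single w 1) =
      a s • Finsupp.single w 1 + b s • Finsupp.single (w * cs.simple s) 1 := by
  rw [cs.isRightDescent_iff] at h
  simp [rightOp, show ¬ cs.length w < cs.length (w * cs.simple s) by omega]

variable {cs a b}

theorem leftOp_eq_rightOp (hab : ConjInvariant cs a b) {s t : B} {w : W}
    (h : cs.simple s * w = w * cs.simple t) :
    leftOp cs a b s (Finsupp.single w 1) = rightOp cs a b t (Finsupp.single w 1) := by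
  have hc : IsConj (cs.simple t) (cs.simple s) := isConj_iff.2 ⟨w, by rw [← h]; simp⟩
  obtain ⟨h1, h2⟩ := hab t s hc
  simp only [leftOp, rightOp, Finsupp.linearCombination_single, one_smul, h, h1, h2]

theorem leftOp_rightOp_comm (hab : ConjInvariant cs a b) (s t : B) :
    leftOp cs a b s * rightOp cs a b t = rightOp cs a b t * leftOp cs a b s := by
  apply Finsupp.lhom_ext'
  intro w
  apply LinearMap.ext_ring
  change leftOp cs a b s (rightOp cs a b t (Finsupp.single w 1)) =
    rightOp cs a b t (leftOp cs a b s (Finsupp.single w 1))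
  by_cases heq : cs.simple s * w = w * cs.simple t
  · have heq' : cs.simple s * (w * cs.simple t) = w * cs.simple t * cs.simple t := by
      rw [← mul_assoc, heq]
    have e1 := leftOp_eq_rightOp hab heq
    have e2 := leftOp_eq_rightOp hab heq'
    rw [e1]
    by_cases hr : cs.IsRightDescent w t
    · rw [rightOp_down cs a b hr]
      simp only [map_add, map_smul, e1, e2]
    · rw [rightOp_up cs a b hr, e2]
  · have hL : cs.IsLeftDescent (w * cs.simple t) s ↔ cs.IsLeftDescent w s := by
      constructor
      · intro h'
        by_contra h
        exact heq (cs.simple_mul_eq_mul_simple h h')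
      · intro h'
        by_contra h
        have := cs.simple_mul_eq_mul_simple (j := t) h (by simpa using h')
        apply heq
        rw [cs.simple_mul_simple_cancel_right, ← mul_assoc] at this
        nth_rewrite 2 [← this]
        simp
    have hR : cs.IsRightDescent (cs.simple s * w) t ↔ cs.IsRightDescent w t := by
      have k1 : ∀ u : W, cs.IsRightDescent u t ↔
          cs.length (u * cs.simple t) < cs.length u := fun u => Iff.rfl
      have m1 := cs.length_mul_simple w t
      have m2 := cs.length_mul_simple (cs.simple s * w) t
      have m3 := cs.length_simple_mul w s
      have m4 := cs.length_simple_mul (w * cs.simple t) s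
      rw [← mul_assoc] at m4
      simp only [CoxeterSystem.IsLeftDescent, CoxeterSystem.IsRightDescent, ← mul_assoc] at hL ⊢
      omega
    by_cases hl : cs.IsLeftDescent w s <;> by_cases hr : cs.IsRightDescent w t
    · simp only [leftOp_down cs a b hl, rightOp_down cs a b hr, map_add, map_smul,
        leftOp_down cs a b (hL.2 hl), rightOp_down cs a b (hR.2 hr), mul_assoc]
      module
    · simp only [leftOp_down cs a b hl, rightOp_up cs a b hr, map_add, map_smul,
        leftOp_down cs a b (hL.2 hl), rightOp_up cs a b (hR.not.2 hr), mul_assoc]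
    · simp only [leftOp_up cs a b hl, rightOp_down cs a b hr, map_add, map_smul,
        leftOp_up cs a b (hL.not.2 hl), rightOp_down cs a b (hR.2 hr), mul_assoc]
    · simp only [leftOp_up cs a b hl, rightOp_up cs a b hr,
        leftOp_up cs a b (hL.not.2 hl), rightOp_up cs a b (hR.not.2 hr), mul_assoc]

theorem prod_leftOp_apply {ω : List B} (hω : cs.IsReduced ω) :
    ((ω.map (leftOp cs a b)).prod) (Finsupp.single 1 1) =
      Finsupp.single (cs.wordProd ω) 1 := by
  induction ω with
  | nil => simp
  | cons i ω ih =>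
    have h1 : cs.IsReduced ω := by simpa using hω.drop 1
    have h2 : ¬ cs.IsLeftDescent (cs.wordProd ω) i := by
      unfold CoxeterSystem.IsLeftDescent
      rw [← cs.wordProd_cons, hω.eq, h1.eq]
      simp
    rw [List.map_cons, List.prod_cons, Module.End.mul_apply, ih h1, leftOp_up cs a b h2,
      cs.wordProd_cons]

theorem prod_rightOp_apply {ω : List B} (hω : cs.IsReduced ω.reverse) :
    ((ω.map (rightOp cs a b)).prod) (Finsupp.single 1 1) =
      Finsupp.single (cs.wordProd ω.reverse) 1 := by
  induction ω with
  | nil => simp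
  | cons i ω ih =>
    rw [List.reverse_cons] at hω
    have h1 : cs.IsReduced ω.reverse := by
      simpa using hω.take ω.length
    have h2 : ¬ cs.IsRightDescent (cs.wordProd ω.reverse) i := by
      unfold CoxeterSystem.IsRightDescent
      have := hω.eq
      rw [cs.wordProd_append, cs.wordProd_singleton] at this
      rw [this, h1.eq]
      simp
    rw [List.map_cons, List.prod_cons, Module.End.mul_apply, ih h1, rightOp_up cs a b h2,
      List.reverse_cons, cs.wordProd_append, cs.wordProd_singleton]

/-- An element of the Hecke algebra is determined by its value on `e_1`. -/
theorem eval_injective (hab : ConjInvariant cs a b) {x y : heckeAlgebra cs a b}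
    (h : (x : Module.End R (W →₀ R)) (Finsupp.single 1 1) =
      (y : Module.End R (W →₀ R)) (Finsupp.single 1 1)) : x = y := by
  have hcomm : ∀ (z : heckeAlgebra cs a b) (ω : List B),
      Commute (z : Module.End R (W →₀ R)) ((ω.map (rightOp cs a b)).prod) := by
    intro z ω
    apply Commute.list_prod_right
    intro r hr
    obtain ⟨t, -, rfl⟩ := List.mem_map.1 hr
    obtain ⟨z, hz⟩ := z
    change Commute z _
    unfold heckeAlgebra at hz
    induction hz using Algebra.adjoin_induction with
    | mem z hz => obtain ⟨s, rfl⟩ := hz; exact leftOp_rightOp_comm hab s t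
    | algebraMap r => exact Algebra.commutes r _
    | add _ _ _ _ h1 h2 => exact h1.add_left h2
    | mul _ _ _ _ h1 h2 => exact h1.mul_left h2
  apply Subtype.ext
  apply Finsupp.lhom_ext'
  intro w
  apply LinearMap.ext_ring
  change (x : Module.End R (W →₀ R)) (Finsupp.single w 1) =
    (y : Module.End R (W →₀ R)) (Finsupp.single w 1)
  obtain ⟨ω, hω, rfl⟩ := cs.exists_isReduced w
  have hr := prod_rightOp_apply (cs := cs) (a := a) (b := b) (ω := ω.reverse) (by simpa using hω)
  rw [List.reverse_reverse] at hr
  have hx := congrArg (fun f => f (Finsupp.single 1 1)) (hcomm x ω.reverse)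
  have hy := congrArg (fun f => f (Finsupp.single 1 1)) (hcomm y ω.reverse)
  simp only [Module.End.mul_apply, hr] at hx hy
  rw [hx, hy, h]

theorem coe_prod_gen (ω : List B) :
    (((ω.map (gen cs a b)).prod : heckeAlgebra cs a b) : Module.End R (W →₀ R)) =
      (ω.map (leftOp cs a b)).prod := by
  rw [← Subalgebra.coe_val, map_list_prod, List.map_map]
  rfl

theorem T_apply_one (w : W) :
    (T cs a b w : Module.End R (W →₀ R)) (Finsupp.single 1 1) = Finsupp.single w 1 := by
  have hs := (cs.exists_isReduced w).choose_spec
  rw [T, coe_prod_gen, prod_leftOp_apply hs.1, ← hs.2]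

theorem T_eq_of_isReduced (hab : ConjInvariant cs a b) {ω : List B} (hω : cs.IsReduced ω) :
    T cs a b (cs.wordProd ω) = (ω.map (gen cs a b)).prod := by
  apply eval_injective hab
  rw [T_apply_one, coe_prod_gen, prod_leftOp_apply hω]

theorem T_one (hab : ConjInvariant cs a b) : T cs a b 1 = 1 := by
  apply eval_injective hab
  rw [T_apply_one]; simp

/-- The elements `T_w` form a basis of the Hecke algebra. -/
theorem T_basis (hab : ConjInvariant cs a b) :
    ∃ β : Module.Basis W R (heckeAlgebra cs a b), ∀ w, β w = T cs a b w := by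
  let ev : heckeAlgebra cs a b →ₗ[R] (W →₀ R) :=
    (LinearMap.applyₗ (Finsupp.single (1 : W) (1 : R))).comp (heckeAlgebra cs a b).val.toLinearMap
  have hev : ∀ w, ev (T cs a b w) = Finsupp.single w 1 := fun w => T_apply_one w
  have hinj : Function.Injective ev := fun x y h => eval_injective hab h
  have hsurj : Function.Surjective ev := by
    intro f
    induction f using Finsupp.induction_linear with
    | zero => exact ⟨0, map_zero _⟩
    | add f g hf hg =>
      obtain ⟨x, rfl⟩ := hf
      obtain ⟨y, rfl⟩ := hg
      exact ⟨x + y, map_add _ _ _⟩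
    | single w r =>
      refine ⟨r • T cs a b w, ?_⟩
      rw [map_smul, hev]
      simp
  refine ⟨⟨LinearEquiv.ofBijective ev ⟨hinj, hsurj⟩⟩, fun w => ?_⟩
  apply hinj
  rw [hev]
  exact LinearEquiv.apply_symm_apply (LinearEquiv.ofBijective ev ⟨hinj, hsurj⟩) _

/-- The multiplication formula that defines the Hecke algebra. -/
theorem T_simple_mul_T (hab : ConjInvariant cs a b) (s : B) (w : W) :
    (cs.length w < cs.length (cs.simple s * w) →
      T cs a b (cs.simple s) * T cs a b w = T cs a b (cs.simple s * w)) ∧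
    (cs.length (cs.simple s * w) < cs.length w →
      T cs a b (cs.simple s) * T cs a b w = a s • T cs a b w + b s • T cs a b (cs.simple s * w)) := by
  have hs : T cs a b (cs.simple s) = gen cs a b s := by
    have := T_eq_of_isReduced hab (ω := [s]) (by simp [CoxeterSystem.IsReduced])
    simpa using this
  have hm : ((T cs a b (cs.simple s) * T cs a b w : heckeAlgebra cs a b) :
      Module.End R (W →₀ R)) (Finsupp.single 1 1) = leftOp cs a b s (Finsupp.single w 1) := by
    rw [hs, Subalgebra.coe_mul, Module.End.mul_apply, T_apply_one]; rfl
  refine ⟨fun h => ?_, fun h => ?_⟩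
  · apply eval_injective hab
    rw [hm, T_apply_one, leftOp_up]
    unfold CoxeterSystem.IsLeftDescent; omega
  · apply eval_injective hab
    rw [hm, leftOp_down _ _ _ (by exact h)]
    simp [T_apply_one]

end Basis

/-- In right-angled type distinct generators are not conjugate, so that all parameters
are admissible. -/
theorem conjInvariant_of_isRightAngled {R : Type*} (hM : IsRightAngled M) (cs : CoxeterSystem M W)
    (a b : B → R) : ConjInvariant cs a b := by
  classical
  intro s t hst
  suffices s = t by subst this; exact ⟨rfl, rfl⟩
  let f : B → Multiplicative (ZMod 2) := fun u => Multiplicative.ofAdd (if u = s then 1 else 0)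
  have hf : M.IsLiftable f := by
    intro u v
    have hsq : ∀ x : Multiplicative (ZMod 2), x ^ 2 = 1 := by decide
    rcases hM u v with h | h | h
    · have huv : u = v := by
        by_contra hne
        exact M.off_diagonal u v hne h
      subst huv
      rw [h, pow_one, ← pow_two, hsq]
    · rw [h, hsq]
    · rw [h, pow_zero]
  have h1 := (cs.lift ⟨f, hf⟩).map_isConj hst
  rw [isConj_iff_eq, cs.lift_apply_simple, cs.lift_apply_simple] at h1
  by_contra hne
  have h2 := congrArg Multiplicative.toAdd h1
  simp [f, Ne.symm hne] at h2

/-- The subspace `[A, A]` spanned by the additive commutators `xy - yx`. -/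
def commutatorSubspace (K A : Type*) [CommRing K] [Ring A] [Algebra K A] : Submodule K A :=
  Submodule.span K {z : A | ∃ x y : A, z = x * y - y * x}

/-- The cocentre `A / [A, A]` of an algebra. -/
abbrev Cocentre (K A : Type*) [CommRing K] [Ring A] [Algebra K A] : Type _ :=
  A ⧸ commutatorSubspace K A

/-- `w` is of minimal length in its conjugacy class. -/
def IsMinLength (cs : CoxeterSystem M W) (w : W) : Prop :=
  ∀ v : W, IsConj w v → cs.length w ≤ cs.length v

end GenericHecke

/-! Completing the square turns each `T_s` into an involution `(2 T_s - a_s) / d_s`, where `d_s` is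
a square root of `a_s² + 4 b_s`, nonzero by hypothesis. These involutions satisfy the right-angled
relations, so they define a homomorphism `φ` from `W` to the Hecke algebra. Expanding a reduced
product gives `T_w = c_w φ(w) +` terms `φ(v)` with `v` shorter and `c_w ≠ 0`. Hence `φ` is a basis,
the Hecke algebra is the group algebra of `W`, and its cocentre has the classes of the `φ(w)` as a
basis. At minimal length representatives the expansion is again triangular, ranked by minimal
length, so the `T_O` form a basis.

Independence of the representative is combinatorial. `T_w` and `T_{sws}` agree in the cocentre when
`sws` and `w` have equal length, and `eq_of_isMinLength` links any two minimal elements by such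
moves. This rests on `lt_length_conj`: if no right descent `s` of `x ≠ 1` satisfies `ℓ(sws) ≤ ℓ(w)`,
then `ℓ(xwx⁻¹) > ℓ(w)`. Behind it is the fact that two right descents of an element commute. -/

/-! ### Inversion parities and commuting descents. -/

section RightAngled

variable {B W : Type*} [Group W] {M : CoxeterMatrix B} (cs : CoxeterSystem M W)

/-- The parity of the number of occurrences of `t` in the right inversion sequence of a word
for `w` (it depends only on `w`). -/
noncomputable def CoxeterSystem.invParity (w t : W) : ZMod 2 :=
  (cs.lift ⟨cs.signedConj, cs.signedConj_isLiftable⟩ w (t, 0)).2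

open Classical in
theorem CoxeterSystem.invParity_wordProd (ω : List B) (t : W) :
    cs.invParity (cs.wordProd ω) t = ((cs.rightInvSeq ω).count t : ZMod 2) := by
  simp [CoxeterSystem.invParity, cs.lift_signedConj_wordProd]

-- The cocycle rule for inversion sets: passing from `w` to `w s` conjugates the set by `s` and
-- toggles `s`.
open Classical in
theorem CoxeterSystem.invParity_mul_simple (w t : W) (i : B) :
    cs.invParity (w * cs.simple i) t =
      (if t = cs.simple i then 1 else 0) +
        cs.invParity w (cs.simple i * t * cs.simple i) := by
  obtain ⟨ω, -, rfl⟩ := cs.exists_isReduced w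
  rw [cs.invParity_wordProd, CoxeterSystem.invParity, map_mul, cs.lift_apply_simple]
  change (cs.lift ⟨cs.signedConj, cs.signedConj_isLiftable⟩ (cs.wordProd ω)
    (cs.signedConj i (t, 0))).2 = _
  rw [CoxeterSystem.signedConj, cs.lift_signedConj_wordProd]
  simp

theorem CoxeterSystem.length_mul_lt_of_invParity {w t : W} (h : cs.invParity w t = 1) :
    cs.length (w * t) < cs.length w := by
  classical
  obtain ⟨ω, hω, rfl⟩ := cs.exists_isReduced w
  rw [cs.invParity_wordProd] at h
  refine (cs.isRightInversion_of_mem_rightInvSeq hω ?_).2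
  by_contra hn
  rw [List.count_eq_zero_of_not_mem hn] at h
  simp at h

/-- By exchange a descent occurs in the inversion sequence of a reduced word, and it occurs only
once there, so its parity is `1`. -/
theorem CoxeterSystem.invParity_simple_iff {w : W} {i : B} :
    cs.invParity w (cs.simple i) = 1 ↔ cs.IsRightDescent w i := by
  classical
  refine ⟨cs.length_mul_lt_of_invParity, fun h => ?_⟩
  obtain ⟨ω, hω, rfl⟩ := cs.exists_isReduced w
  rw [cs.invParity_wordProd,
    List.count_eq_one_of_mem hω.nodup_rightInvSeq (cs.simple_mem_rightInvSeq h), Nat.cast_one]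

theorem CoxeterSystem.commute_simple {i j : B} (h : M i j = 2) :
    Commute (cs.simple i) (cs.simple j) := by
  have h1 := cs.simple_mul_simple_pow i j
  rw [h, pow_two] at h1
  have h2 := eq_inv_of_mul_eq_one_left h1
  rw [mul_inv_rev, cs.inv_simple, cs.inv_simple] at h2
  exact h2

open GenericHecke

theorem CoxeterSystem.simple_injective_of_isRightAngled (hM : IsRightAngled M) :
    Function.Injective cs.simple := by
  intro i j h
  -- With `id : B → B` as parameter family, equality of the parameters is equality of the indices.
  exact (conjInvariant_of_isRightAngled hM cs id id i j (by rw [h])).1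

/-- Conjugation by `s_j` fixes `s_i ≠ s_j`, so the cocycle rule leaves its parity unchanged. -/
theorem CoxeterSystem.isRightDescent_mul_simple_iff (hM : IsRightAngled M) {i j : B} (hij : i ≠ j)
    (h : M i j = 2) {u : W} :
    cs.IsRightDescent (u * cs.simple j) i ↔ cs.IsRightDescent u i := by
  classical
  rw [← cs.invParity_simple_iff, cs.invParity_mul_simple, if_neg ((cs.simple_injective_of_isRightAngled hM).ne hij), ← (cs.commute_simple h).eq,
    cs.simple_mul_simple_cancel_right, zero_add, cs.invParity_simple_iff]

/-- `W` maps to the infinite dihedral group `DihedralGroup 0`: `s_i` and `s_j` go to two adjacent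
reflections, every other generator goes to `1`, and `s_i s_j` goes to the translation `r 1`. -/
theorem CoxeterSystem.simple_mul_simple_zpow_eq_one (hM : IsRightAngled M) {i j : B}
    (hij : i ≠ j) (h0 : M i j = 0) {k : ℤ} (h : (cs.simple i * cs.simple j) ^ k = 1) : k = 0 := by
  classical
  let f : B → DihedralGroup 0 := fun u =>
    if u = i then DihedralGroup.sr 0 else if u = j then DihedralGroup.sr 1 else 1
  have hsq : ∀ u, f u ^ 2 = 1 := by
    intro u
    simp only [f]
    split_ifs <;> simp [pow_two]
  have hf : M.IsLiftable f := by
    intro u v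
    by_cases huv : u = v
    · subst huv
      rw [M.diagonal, pow_one, ← pow_two, hsq]
    rcases hM u v with h | h | h
    · exact absurd h (M.off_diagonal u v huv)
    · rw [h]
      by_cases hu : u = i ∨ u = j
      · by_cases hv : v = i ∨ v = j
        · rcases hu with rfl | rfl <;> rcases hv with rfl | rfl
          · exact absurd rfl huv
          · omega
          · have := M.symmetric u v; omega
          · exact absurd rfl huv
        · have : f v = 1 := by simp only [f]; push Not at hv; rw [if_neg hv.1, if_neg hv.2]
          rw [this, mul_one, hsq]
      · have : f u = 1 := by simp only [f]; push Not at hu; rw [if_neg hu.1, if_neg hu.2]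
        rw [this, one_mul, hsq]
    · rw [h, pow_zero]
  have h1 := congrArg (cs.lift ⟨f, hf⟩) h
  rw [map_zpow, map_mul, cs.lift_apply_simple, cs.lift_apply_simple, map_one] at h1
  have h2 : f i * f j = DihedralGroup.r 1 := by simp [f, Ne.symm hij]
  rw [h2, DihedralGroup.r_zpow, DihedralGroup.one_def] at h1
  have h3 := DihedralGroup.r.inj h1
  simpa using h3

/-- Right multiplication by `⟨s_i, s_j⟩`, with `s_i s_j` of infinite order, preserves the property
that the reflections `(s_i s_j) ^ k s_i` inverted by `u` are indexed by an interval of `ℤ` with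
end points `-1` or `0`. -/
theorem CoxeterSystem.invParity_interval (hM : IsRightAngled M) {i j : B} (hij : i ≠ j)
    (h0 : M i j = 0) (v : W) (hv : ∀ k : ℤ,
      cs.invParity v ((cs.simple i * cs.simple j) ^ k * cs.simple i) ≠ 1)
    {g : W} (hg : g ∈ Subgroup.closure {cs.simple i, cs.simple j}) :
    ∃ n : ℤ, 0 ≤ n ∧
      ((∀ k : ℤ, cs.invParity (v * g) ((cs.simple i * cs.simple j) ^ k * cs.simple i) = 1 ↔
          0 ≤ k ∧ k < n) ∨
       (∀ k : ℤ, cs.invParity (v * g) ((cs.simple i * cs.simple j) ^ k * cs.simple i) = 1 ↔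
          -n ≤ k ∧ k < 0)) := by
  classical
  set c := cs.simple i * cs.simple j with hc
  have hsi : ∀ k : ℤ, cs.simple i * c ^ k = c ^ (-k) * cs.simple i := by
    intro k
    have h1 : SemiconjBy (cs.simple i) c c⁻¹ := by
      simp [SemiconjBy, hc, mul_assoc]
    have := h1.zpow_right k
    rw [inv_zpow'] at this
    exact this
  -- On the index `k` of the reflection `c ^ k s_i`, conjugation by `s_i` is `k ↦ -k` and
  -- conjugation by `s_j` is `k ↦ -2 - k`; the generators themselves have indices `0` and `-1`.
  have ti : ∀ k : ℤ, cs.simple i * (c ^ k * cs.simple i) * cs.simple i = c ^ (-k) * cs.simple i := by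
    intro k
    rw [← hsi]; simp [mul_assoc]
  have hj : cs.simple j = c ^ (-1 : ℤ) * cs.simple i := by simp [hc, mul_assoc]
  have tj : ∀ k : ℤ, cs.simple j * (c ^ k * cs.simple i) * cs.simple j =
      c ^ (-2 - k) * cs.simple i := by
    intro k
    rw [mul_assoc, mul_assoc, ← hc, ← zpow_add_one, hj, mul_assoc, hsi, ← mul_assoc, ← zpow_add]
    congr 2; ring
  have inj0 : ∀ k : ℤ, c ^ k * cs.simple i = cs.simple i ↔ k = 0 := by
    intro k
    refine ⟨fun h => cs.simple_mul_simple_zpow_eq_one hM hij h0 (mul_eq_right.1 h), ?_⟩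
    rintro rfl; simp
  have inj1 : ∀ k : ℤ, c ^ k * cs.simple i = cs.simple j ↔ k = -1 := by
    intro k
    constructor
    · intro h
      have h1 : c ^ (k + 1) = 1 := by
        rw [zpow_add_one, hc, ← mul_assoc, h]; simp
      have := cs.simple_mul_simple_zpow_eq_one hM hij h0 h1
      omega
    · rintro rfl; exact hj.symm
  have z2 : ∀ x : ZMod 2, (1 + x = 1 ↔ ¬ x = 1) := by decide
  have stepi : ∀ (u : W) (k : ℤ), cs.invParity (u * cs.simple i) (c ^ k * cs.simple i) = 1 ↔
      (k = 0 ∧ ¬ cs.invParity u (c ^ (-k) * cs.simple i) = 1) ∨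
      (k ≠ 0 ∧ cs.invParity u (c ^ (-k) * cs.simple i) = 1) := by
    intro u k
    rw [cs.invParity_mul_simple, ti, inj0]
    by_cases hk : k = 0
    · simp only [hk, if_true, z2]; simp
    · simp [hk]
  have stepj : ∀ (u : W) (k : ℤ), cs.invParity (u * cs.simple j) (c ^ k * cs.simple i) = 1 ↔
      (k = -1 ∧ ¬ cs.invParity u (c ^ (-2 - k) * cs.simple i) = 1) ∨
      (k ≠ -1 ∧ cs.invParity u (c ^ (-2 - k) * cs.simple i) = 1) := by
    intro u k
    rw [cs.invParity_mul_simple, tj, inj1]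
    by_cases hk : k = -1
    · simp only [hk, if_true, z2]; simp
    · simp [hk]
  -- Reflecting `[0, n)` in `0` and toggling `0` gives `[-(n-1), 0)`, or `[0, 1)` if `n = 0`;
  -- likewise `[-n, 0)` becomes `[0, n+1)`. For `s_j` the reflection is in `-1`, with the two types
  -- of interval exchanged.
  have hi' : ∀ u, (∃ n : ℤ, 0 ≤ n ∧
      ((∀ k : ℤ, cs.invParity u (c ^ k * cs.simple i) = 1 ↔ 0 ≤ k ∧ k < n) ∨
       (∀ k : ℤ, cs.invParity u (c ^ k * cs.simple i) = 1 ↔ -n ≤ k ∧ k < 0))) →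
      (∃ n : ℤ, 0 ≤ n ∧
      ((∀ k : ℤ, cs.invParity (u * cs.simple i) (c ^ k * cs.simple i) = 1 ↔ 0 ≤ k ∧ k < n) ∨
       (∀ k : ℤ, cs.invParity (u * cs.simple i) (c ^ k * cs.simple i) = 1 ↔ -n ≤ k ∧ k < 0))) := by
    rintro u ⟨n, hn, h | h⟩
    · by_cases hn0 : n = 0
      · exact ⟨1, by omega, Or.inl fun k => by rw [stepi, h]; omega⟩
      · exact ⟨n - 1, by omega, Or.inr fun k => by rw [stepi, h]; omega⟩
    · exact ⟨n + 1, by omega, Or.inl fun k => by rw [stepi, h]; omega⟩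
  have hj' : ∀ u, (∃ n : ℤ, 0 ≤ n ∧
      ((∀ k : ℤ, cs.invParity u (c ^ k * cs.simple i) = 1 ↔ 0 ≤ k ∧ k < n) ∨
       (∀ k : ℤ, cs.invParity u (c ^ k * cs.simple i) = 1 ↔ -n ≤ k ∧ k < 0))) →
      (∃ n : ℤ, 0 ≤ n ∧
      ((∀ k : ℤ, cs.invParity (u * cs.simple j) (c ^ k * cs.simple i) = 1 ↔ 0 ≤ k ∧ k < n) ∨
       (∀ k : ℤ, cs.invParity (u * cs.simple j) (c ^ k * cs.simple i) = 1 ↔ -n ≤ k ∧ k < 0))) := by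
    rintro u ⟨n, hn, h | h⟩
    · exact ⟨n + 1, by omega, Or.inr fun k => by rw [stepj, h]; omega⟩
    · by_cases hn0 : n = 0
      · exact ⟨1, by omega, Or.inr fun k => by rw [stepj, h]; omega⟩
      · exact ⟨n - 1, by omega, Or.inl fun k => by rw [stepj, h]; omega⟩
  induction hg using Subgroup.closure_induction_right with
  | one => exact ⟨0, le_rfl, Or.inl fun k => by rw [mul_one]; simp only [hv k, false_iff]; omega⟩
  | mul_right x y hx hy ih =>
    rw [← mul_assoc]
    rcases hy with rfl | rfl
    · exact hi' _ ih
    · exact hj' _ ih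
  | mul_inv_cancel x y hx hy ih =>
    rw [← mul_assoc]
    rcases hy with rfl | rfl
    · rw [cs.inv_simple]; exact hi' _ ih
    · rw [cs.inv_simple]; exact hj' _ ih

/-- In right-angled type, two right descents of an element commute. -/
theorem CoxeterSystem.matrix_eq_two_of_isRightDescent (hM : IsRightAngled M) {i j : B} (hij : i ≠ j)
    {u : W} (hi : cs.IsRightDescent u i) (hj : cs.IsRightDescent u j) : M i j = 2 := by
  rcases hM i j with h | h | h0
  · exact absurd h (M.off_diagonal i j hij)
  · exact h
  exfalso
  let H : Subgroup W := Subgroup.closure {cs.simple i, cs.simple j}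
  -- A shortest element `u g` of the coset `u H` inverts no reflection of `H`; `invParity_interval`
  -- then carries this starting point back to `u`.
  obtain ⟨g, -, hg⟩ := (measure fun g : H => cs.length (u * g)).wf.has_min Set.univ ⟨1, trivial⟩
  have hiH : cs.simple i ∈ H := Subgroup.subset_closure (by simp)
  have hjH : cs.simple j ∈ H := Subgroup.subset_closure (by simp)
  have hv : ∀ k : ℤ, cs.invParity (u * g)
      ((cs.simple i * cs.simple j) ^ k * cs.simple i) ≠ 1 := by
    intro k hk
    have h1 := cs.length_mul_lt_of_invParity hk
    rw [mul_assoc] at h1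
    exact hg (g * ⟨_, H.mul_mem (H.zpow_mem (H.mul_mem hiH hjH) k) hiH⟩) trivial h1
  obtain ⟨n, hn, h⟩ := cs.invParity_interval hM hij h0 _ hv (H.inv_mem g.2)
  rw [mul_inv_cancel_right] at h
  have e0 : (cs.simple i * cs.simple j) ^ (0 : ℤ) * cs.simple i = cs.simple i := by simp
  have e1 : (cs.simple i * cs.simple j) ^ (-1 : ℤ) * cs.simple i = cs.simple j := by
    simp [mul_assoc]
  rw [← cs.invParity_simple_iff] at hi hj
  rw [← e0] at hi
  rw [← e1] at hj
  -- Neither type of interval contains both `0` and `-1`.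
  rcases h with h | h <;> rw [h] at hi hj <;> omega

end RightAngled

/-! ### Length under conjugation and minimal elements. -/

section CyclicShift

open GenericHecke

variable {B W : Type*} [Group W] {M : CoxeterMatrix B} (cs : CoxeterSystem M W)

/-- The last letter `s` of `y` moves over to `x`: `x y⁻¹ = (x s)(y s)⁻¹`. Disjointness survives,
because a common descent of `x s` and `y s` commutes with the descent `s` of `x s`, hence would
already be a common descent of `x` and `y`. -/
theorem CoxeterSystem.length_mul_inv_of_disjoint (hM : IsRightAngled M) (x y : W)
    (h : ∀ i, cs.IsRightDescent x i → ¬ cs.IsRightDescent y i) :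
    cs.length (x * y⁻¹) = cs.length x + cs.length y := by
  induction hn : cs.length y generalizing x y with
  | zero => rw [cs.length_eq_zero_iff] at hn; simp [hn]
  | succ n ih =>
    obtain ⟨i, hi⟩ := cs.exists_rightDescent_of_ne_one (w := y) (by rintro rfl; simp at hn)
    have hx : ¬ cs.IsRightDescent x i := fun hx => h i hx hi
    have hl := cs.isRightDescent_iff.1 hi
    have key : ∀ k, cs.IsRightDescent (x * cs.simple i) k →
        ¬ cs.IsRightDescent (y * cs.simple i) k := by
      intro k h1 h2
      have hki : k ≠ i := by
        rintro rfl
        exact cs.isRightDescent_iff_not_isRightDescent_mul.1 hi h2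
      have hxi : cs.IsRightDescent (x * cs.simple i) i := by
        rw [cs.isRightDescent_iff_not_isRightDescent_mul]; simpa using hx
      have hm := cs.matrix_eq_two_of_isRightDescent hM hki h1 hxi
      rw [cs.isRightDescent_mul_simple_iff hM hki hm] at h1 h2
      exact h k h1 h2
    have := ih _ _ key (by omega)
    rw [cs.not_isRightDescent_iff.1 hx, mul_inv_rev, cs.inv_simple, ← mul_assoc,
      cs.simple_mul_simple_cancel_right] at this
    omega

/-- A last letter `k` of `w` is, like `i`, a right descent of `x w`. So `s_i` commutes with `s_k`,
and both hypotheses pass to `w s_k`. -/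
theorem CoxeterSystem.commute_of_isRightDescent_mul (hM : IsRightAngled M) (x w : W) {i : B}
    (h : cs.length (x * w) = cs.length x + cs.length w)
    (h1 : cs.IsRightDescent (x * w) i) (h2 : ¬ cs.IsRightDescent w i) :
    Commute (cs.simple i) w := by
  induction hn : cs.length w generalizing w with
  | zero => rw [cs.length_eq_zero_iff] at hn; simp [hn]
  | succ n ih =>
    obtain ⟨k, hk⟩ := cs.exists_rightDescent_of_ne_one (w := w) (by rintro rfl; simp at hn)
    have hl := cs.isRightDescent_iff.1 hk
    have h3 := cs.length_mul_simple (x * w) k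
    have h4 := cs.length_mul_le x (w * cs.simple k)
    rw [mul_assoc] at h3
    have hxk : cs.IsRightDescent (x * w) k := by
      unfold CoxeterSystem.IsRightDescent; rw [mul_assoc]; omega
    have hik : i ≠ k := by rintro rfl; exact h2 hk
    have hm := cs.matrix_eq_two_of_isRightDescent hM hik h1 hxk
    rw [← cs.isRightDescent_mul_simple_iff hM hik hm] at h1 h2
    have := ih (w * cs.simple k) (by omega) (by rwa [mul_assoc] at h1) h2 (by omega)
    simpa using this.mul_right (cs.commute_simple hm)

/-- No cancellation occurs: `ℓ(xwx⁻¹) = 2 ℓ(x) + ℓ(w)`. A descent shared by `x w` and `x` would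
commute with `w`, contradicting `ℓ(sws) > ℓ(w)`. -/
theorem CoxeterSystem.lt_length_conj (hM : IsRightAngled M) {x w : W} (hx : x ≠ 1)
    (h : ∀ i, cs.IsRightDescent x i →
      cs.length w < cs.length (cs.simple i * w * cs.simple i)) :
    cs.length w < cs.length (x * w * x⁻¹) := by
  have hR : ∀ i, cs.IsRightDescent x i → ¬ cs.IsRightDescent w i := by
    intro i hi hw
    have := h i hi
    have h1 := cs.isRightDescent_iff.1 hw
    have h2 := cs.length_simple_mul (w * cs.simple i) i
    rw [← mul_assoc] at h2
    have h3 := cs.length_simple_mul w i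
    have h4 := cs.length_mul_simple (cs.simple i * w) i
    omega
  have hL : ∀ i, cs.IsRightDescent x i → ¬ cs.IsRightDescent w⁻¹ i := by
    intro i hi hw
    rw [cs.isRightDescent_inv_iff] at hw
    have := h i hi
    have h1 := cs.isLeftDescent_iff.1 hw
    have h4 := cs.length_mul_simple (cs.simple i * w) i
    omega
  have h1 := cs.length_mul_inv_of_disjoint hM x w⁻¹ hL
  rw [inv_inv, cs.length_inv] at h1
  have h2 := cs.length_mul_inv_of_disjoint hM (x * w) x fun i hi hxi => by
    have hc := cs.commute_of_isRightDescent_mul hM x w h1 hi (hR i hxi)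
    have := h i hxi
    rw [hc.eq, cs.simple_mul_simple_cancel_right] at this
    exact lt_irrefl _ this
  have h3 : cs.length x ≠ 0 := fun h => hx (cs.length_eq_zero_iff.1 h)
  omega

/-- A function that is invariant under length-preserving conjugation by generators takes the same
value at all elements of minimal length of a conjugacy class. -/
theorem CoxeterSystem.eq_of_isMinLength (hM : IsRightAngled M) {X : Type*} (f : W → X)
    (hf : ∀ (w : W) (i : B), cs.length (cs.simple i * w * cs.simple i) = cs.length w →
      f (cs.simple i * w * cs.simple i) = f w)
    {w w' : W} (hw : IsMinLength cs w) (hw' : IsMinLength cs w') (h : IsConj w w') :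
    f w = f w' := by
  obtain ⟨x, rfl⟩ := isConj_iff.1 h
  clear h
  induction hn : cs.length x generalizing x w with
  | zero => rw [cs.length_eq_zero_iff] at hn; simp [hn]
  | succ n ih =>
    have hx : x ≠ 1 := by rintro rfl; simp at hn
    have hle : cs.length (x * w * x⁻¹) ≤ cs.length w :=
      hw' _ (isConj_iff.2 ⟨x⁻¹, by group⟩)
    -- Some right descent of `x` does not lengthen `w`; by minimality of `w` it preserves the
    -- length, and it is split off from `x`.
    obtain ⟨i, hi, hl⟩ : ∃ i, cs.IsRightDescent x i ∧
        cs.length (cs.simple i * w * cs.simple i) ≤ cs.length w := by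
      by_contra! hcon
      exact absurd (cs.lt_length_conj hM hx hcon) (by omega)
    have hc : IsConj w (cs.simple i * w * cs.simple i) := isConj_iff.2 ⟨cs.simple i, by simp⟩
    have heq := le_antisymm hl (hw _ hc)
    have e : x * cs.simple i * (cs.simple i * w * cs.simple i) * (x * cs.simple i)⁻¹ =
        x * w * x⁻¹ := by simp [mul_assoc]
    have := ih (w := cs.simple i * w * cs.simple i) (fun v hv => heq ▸ hw v (hc.trans hv))
      (x := x * cs.simple i) (by rwa [e])
      (by have := cs.isRightDescent_iff.1 hi; omega)
    rw [e, hf w i heq] at this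
    exact this

/-- A length-preserving conjugation by a generator is trivial or a cyclic shift of a reduced
word. -/
theorem CoxeterSystem.conj_simple_cases {w : W} {i : B}
    (h : cs.length (cs.simple i * w * cs.simple i) = cs.length w) :
    cs.simple i * w * cs.simple i = w ∨ cs.IsLeftDescent w i ∨ cs.IsRightDescent w i := by
  by_contra! hcon
  obtain ⟨h1, h2, h3⟩ := hcon
  rw [cs.not_isRightDescent_iff] at h3
  have h4 : cs.IsLeftDescent (w * cs.simple i) i := by
    unfold CoxeterSystem.IsLeftDescent; rw [← mul_assoc]; omega
  apply h1
  rw [cs.simple_mul_eq_mul_simple h2 h4, cs.simple_mul_simple_cancel_right]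

end CyclicShift

/-! ### Relations in the Hecke algebra and its cocentre. -/

namespace GenericHecke

section Hecke

variable {B W R : Type*} [Group W] [CommRing R] {M : CoxeterMatrix B} {cs : CoxeterSystem M W}
  {a b : B → R}

theorem T_simple_mul (hab : ConjInvariant cs a b) {i : B} {u : W} (h : ¬ cs.IsLeftDescent u i) :
    T cs a b (cs.simple i * u) = gen cs a b i * T cs a b u := by
  obtain ⟨ω, hω, rfl⟩ := cs.exists_isReduced u
  rw [cs.not_isLeftDescent_iff, ← cs.wordProd_cons, hω.eq] at h
  rw [← cs.wordProd_cons, T_eq_of_isReduced hab hω, T_eq_of_isReduced hab (ω := i :: ω) h]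
  simp

theorem T_mul_simple (hab : ConjInvariant cs a b) {i : B} {u : W} (h : ¬ cs.IsRightDescent u i) :
    T cs a b (u * cs.simple i) = T cs a b u * gen cs a b i := by
  obtain ⟨ω, hω, rfl⟩ := cs.exists_isReduced u
  have e : cs.wordProd ω * cs.simple i = cs.wordProd (ω ++ [i]) := by
    rw [cs.wordProd_append, cs.wordProd_singleton]
  rw [cs.not_isRightDescent_iff, e, hω.eq] at h
  rw [e, T_eq_of_isReduced hab hω, T_eq_of_isReduced hab (ω := ω ++ [i])
    (by simpa [CoxeterSystem.IsReduced] using h)]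
  simp

theorem T_simple (hab : ConjInvariant cs a b) (i : B) :
    T cs a b (cs.simple i) = gen cs a b i := by
  simpa using T_eq_of_isReduced hab (ω := [i]) (by simp [CoxeterSystem.IsReduced])

theorem mkQ_T_conj_simple (hab : ConjInvariant cs a b) (w : W) (i : B)
    (h : cs.length (cs.simple i * w * cs.simple i) = cs.length w) :
    (commutatorSubspace R (heckeAlgebra cs a b)).mkQ (T cs a b (cs.simple i * w * cs.simple i)) =
      (commutatorSubspace R (heckeAlgebra cs a b)).mkQ (T cs a b w) := by
  -- Here `T_{su} - T_{us}` is the commutator of `T_s` and `T_u`; a nontrivial length-preserving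
  -- conjugation exchanges two such elements `su` and `us`.
  have key : ∀ u : W, ¬ cs.IsLeftDescent u i → ¬ cs.IsRightDescent u i →
      (commutatorSubspace R (heckeAlgebra cs a b)).mkQ (T cs a b (cs.simple i * u)) =
      (commutatorSubspace R (heckeAlgebra cs a b)).mkQ (T cs a b (u * cs.simple i)) := by
    intro u h1 h2
    rw [T_simple_mul hab h1, T_mul_simple hab h2]
    exact (Submodule.Quotient.eq _).2 (Submodule.subset_span ⟨_, _, rfl⟩)
  rcases cs.conj_simple_cases h with h1 | h1 | h1
  · rw [h1]
  · have h2 := cs.isLeftDescent_iff.1 h1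
    have := key (cs.simple i * w) (cs.isLeftDescent_iff_not_isLeftDescent_mul.1 h1)
      (by rw [cs.not_isRightDescent_iff]; omega)
    rw [cs.simple_mul_simple_cancel_left] at this
    exact this.symm
  · have h2 := cs.isRightDescent_iff.1 h1
    have := key (w * cs.simple i)
      (by rw [cs.not_isLeftDescent_iff, ← mul_assoc]; omega)
      (cs.isRightDescent_iff_not_isRightDescent_mul.1 h1)
    rw [cs.simple_mul_simple_cancel_right, ← mul_assoc] at this
    exact this

theorem gen_mul_self (hab : ConjInvariant cs a b) (i : B) :
    gen cs a b i * gen cs a b i = a i • gen cs a b i + b i • 1 := by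
  have := (T_simple_mul_T hab i (cs.simple i)).2 (by simp)
  rwa [cs.simple_mul_simple_self, T_one hab, T_simple hab] at this

/-- Both products equal `T` of the same element `s_i s_j = s_j s_i`. -/
theorem gen_commute (hM : IsRightAngled M) {i j : B} (hij : i ≠ j) (h : M i j = 2) :
    Commute (gen cs a b i) (gen cs a b j) := by
  have hab := conjInvariant_of_isRightAngled hM cs a b
  have hne : ∀ {i j : B}, i ≠ j → ¬ cs.IsLeftDescent (cs.simple j) i := by
    intro i j hij h
    unfold CoxeterSystem.IsLeftDescent at h
    rw [cs.length_simple, Nat.lt_one_iff, cs.length_eq_zero_iff] at h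
    apply cs.simple_injective_of_isRightAngled hM |>.ne hij
    simpa using eq_inv_of_mul_eq_one_left h
  rw [Commute, SemiconjBy, ← T_simple hab j, ← T_simple_mul hab (hne hij), T_simple hab j,
    ← T_simple hab i, ← T_simple_mul hab (hne hij.symm), (cs.commute_simple h).eq]

end Hecke

end GenericHecke

/-! ### Triangular changes of basis. -/

section Triangular

variable {ι K V : Type*} [Field K] [AddCommGroup V] [Module K V]

open Submodule in
/-- A family that is triangular, with nonzero diagonal, with respect to a basis and a rank function
with values in `ℕ` is a basis. -/
theorem exists_basis_of_triangular (β : Module.Basis ι K V) (v : ι → V) (rk : ι → ℕ) (c : ι → K)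
    (hc : ∀ i, c i ≠ 0) (h : ∀ i, v i - c i • β i ∈ span K (β '' {j | rk j < rk i})) :
    ∃ γ : Module.Basis ι K V, ∀ i, γ i = v i := by
  have hzero : ∀ i j, rk j ≤ rk i → j ≠ i → β.repr (v j) i = 0 := by
    intro i j hij hne
    have h1 : β.repr (v j - c j • β j) i = 0 := by
      have h2 := (β.mem_span_image).1 (h j)
      by_contra hcon
      have h3 : rk i < rk j := h2 (Finsupp.mem_support_iff.2 hcon)
      omega
    rw [map_sub, Finsupp.sub_apply, map_smul, β.repr_self] at h1
    simpa [hne] using h1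
  have hdiag : ∀ i, β.repr (v i) i = c i := by
    intro i
    have h1 : β.repr (v i - c i • β i) i = 0 := by
      have h2 := (β.mem_span_image).1 (h i)
      by_contra hcon
      have h3 : rk i < rk i := h2 (Finsupp.mem_support_iff.2 hcon)
      omega
    rw [map_sub, Finsupp.sub_apply, map_smul, β.repr_self] at h1
    simpa [sub_eq_zero] using h1
  have hli : LinearIndependent K v := by
    rw [linearIndependent_iff]
    intro l hl
    by_contra hne
    -- At an index of maximal rank in the support, only the diagonal term contributes to the
    -- coordinate.
    obtain ⟨i, hi, hmax⟩ := l.support.exists_max_image rk (Finsupp.support_nonempty_iff.2 hne)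
    have h1 := congrArg (fun x => β.repr x i) hl
    simp only [Finsupp.linearCombination_apply, Finsupp.sum, map_sum, map_smul, map_zero,
      Finsupp.finsetSum_apply, Finsupp.smul_apply, Finsupp.zero_apply] at h1
    rw [Finset.sum_eq_single_of_mem i hi fun j hj hji => by
      rw [hzero i j (hmax j hj) hji, smul_zero], hdiag, smul_eq_mul] at h1
    exact mul_ne_zero (Finsupp.mem_support_iff.1 hi) (hc i) h1
  have hmem : ∀ n i, rk i < n → β i ∈ span K (Set.range v) := by
    intro n
    induction n with
    | zero => intro i hi; omega
    | succ n ih =>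
      intro i hi
      have h1 : span K (β '' {j | rk j < rk i}) ≤ span K (Set.range v) := by
        rw [span_le]
        rintro _ ⟨j, hj, rfl⟩
        exact ih j (lt_of_lt_of_le hj (by omega))
      have h2 : c i • β i ∈ span K (Set.range v) := by
        have := sub_mem (subset_span (Set.mem_range_self i)) (h1 (h i))
        rwa [sub_sub_cancel] at this
      exact (smul_mem_iff _ (hc i)).1 h2
  refine ⟨Module.Basis.mk hli ?_, fun i => Module.Basis.mk_apply _ _ _⟩
  rw [← β.span_eq, span_le]
  rintro _ ⟨i, rfl⟩
  exact hmem (rk i + 1) i (by omega)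

open Submodule in
/-- A family with respect to which a basis is triangular, with nonzero diagonal, is a basis. -/
theorem exists_basis_of_triangular' (β : Module.Basis ι K V) (v : ι → V) (rk : ι → ℕ) (c : ι → K)
    (hc : ∀ i, c i ≠ 0) (h : ∀ i, β i - c i • v i ∈ span K (v '' {j | rk j < rk i})) :
    ∃ γ : Module.Basis ι K V, ∀ i, γ i = v i := by
  -- The inverse of a triangular matrix is triangular, by induction on the rank.
  have key : ∀ n i, rk i < n → v i - (c i)⁻¹ • β i ∈ span K (β '' {j | rk j < rk i}) := by
    intro n
    induction n with
    | zero => intro i hi; omega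
    | succ n ih =>
      intro i hi
      have h1 : span K (v '' {j | rk j < rk i}) ≤ span K (β '' {j | rk j < rk i}) := by
        rw [span_le]
        rintro _ ⟨j, hj, rfl⟩
        have hj' : rk j < rk i := hj
        have h2 : span K (β '' {k | rk k < rk j}) ≤ span K (β '' {j | rk j < rk i}) :=
          span_mono (Set.image_mono fun k (hk : rk k < rk j) => hk.trans hj')
        have := add_mem (h2 (ih j (by omega))) (smul_mem _ (c j)⁻¹
          (subset_span (Set.mem_image_of_mem β hj)))
        rwa [sub_add_cancel] at this
      have e : v i - (c i)⁻¹ • β i = (-(c i)⁻¹) • (β i - c i • v i) := by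
        rw [smul_sub, smul_smul, neg_mul, inv_mul_cancel₀ (hc i)]
        module
      rw [e]
      exact smul_mem _ _ (h1 (h i))
  exact exists_basis_of_triangular β v rk (fun i => (c i)⁻¹) (fun i => inv_ne_zero (hc i))
    fun i => key _ i (Nat.lt_succ_self _)

end Triangular

/-! ### The cocentre of a group algebra. -/

namespace GenericHecke

section GroupBasis

variable {W K A : Type*} [Group W] [Field K] [Ring A] [Algebra K A]

/-- The cocentre of a group algebra has a basis indexed by the conjugacy classes. -/
theorem exists_basis_cocentre (φ : W →* A) (β : Module.Basis W K A) (hβ : ∀ w, β w = φ w) :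
    ∃ γ : Module.Basis (ConjClasses W) K (Cocentre K A),
      ∀ w, γ (ConjClasses.mk w) = (commutatorSubspace K A).mkQ (φ w) := by
  -- `F` records the class of each basis element; it is a trace, so it factors through the cocentre.
  let F : A →ₗ[K] (ConjClasses W →₀ K) :=
    β.constr K fun w => Finsupp.single (ConjClasses.mk w) (1 : K)
  have hF : ∀ w, F (φ w) = Finsupp.single (ConjClasses.mk w) 1 := fun w => by
    rw [← hβ]; exact β.constr_basis K _ w
  have hcomm : ∀ x y, F (x * y) = F (y * x) := by
    have h1 : (LinearMap.mul K A).compr₂ F = ((LinearMap.mul K A).flip).compr₂ F := by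
      apply β.ext
      intro g
      apply β.ext
      intro h
      simp only [LinearMap.compr₂_apply, LinearMap.flip_apply, LinearMap.mul_apply', hβ,
        ← map_mul, hF]
      rw [ConjClasses.mk_eq_mk_iff_isConj.2
        (isConj_iff.2 ⟨g⁻¹, by group⟩ : IsConj (g * h) (h * g))]
    intro x y
    exact congrArg (fun f => f x y) h1
  have hker : commutatorSubspace K A ≤ LinearMap.ker F := by
    unfold commutatorSubspace
    rw [Submodule.span_le]
    rintro _ ⟨x, y, rfl⟩
    simp [hcomm x y]
  have hconj : ∀ v w : W, IsConj v w →
      (commutatorSubspace K A).mkQ (φ v) = (commutatorSubspace K A).mkQ (φ w) := by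
    intro v w h
    obtain ⟨x, rfl⟩ := isConj_iff.1 h
    -- The commutator of `x⁻¹` and `x v` is `v - x v x⁻¹`.
    refine (Submodule.Quotient.eq _).2 (Submodule.subset_span ⟨φ x⁻¹, φ (x * v), ?_⟩)
    rw [← map_mul, ← map_mul]
    simp
  let G : (ConjClasses W →₀ K) →ₗ[K] Cocentre K A :=
    Finsupp.linearCombination K fun O => (commutatorSubspace K A).mkQ (φ O.out)
  have hG : ∀ w, G (Finsupp.single (ConjClasses.mk w) 1) =
      (commutatorSubspace K A).mkQ (φ w) := by
    intro w
    simp only [G, Finsupp.linearCombination_single, one_smul]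
    exact hconj _ _ (ConjClasses.mk_eq_mk_iff_isConj.1 (Quotient.out_eq _))
  let e : Cocentre K A ≃ₗ[K] (ConjClasses W →₀ K) := LinearEquiv.ofLinearMap
    ((commutatorSubspace K A).liftQ F hker) G
    (by
      apply Finsupp.lhom_ext'
      intro O
      apply LinearMap.ext_ring
      obtain ⟨w, rfl⟩ := ConjClasses.exists_rep O
      change (commutatorSubspace K A).liftQ F hker (G (Finsupp.single _ 1)) = _
      rw [hG, Submodule.mkQ_apply, Submodule.liftQ_apply, hF]
      rfl)
    (by
      apply Submodule.linearMap_qext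
      apply β.ext
      intro w
      change G ((commutatorSubspace K A).liftQ F hker ((commutatorSubspace K A).mkQ (β w))) = _
      rw [hβ, Submodule.mkQ_apply, Submodule.liftQ_apply, hF, hG]
      rw [← hβ]; rfl)
  exact ⟨⟨e⟩, hG⟩

end GroupBasis

/-! ### From Hecke generators to involutions. -/

section Deformation

variable {B W K A : Type*} [Group W] {M : CoxeterMatrix B} (cs : CoxeterSystem M W) [Field K]
  [Ring A] [Algebra K A]

/-- Elements that satisfy separable quadratic relations and commute according to a right-angled
Coxeter matrix are affine functions of the generators of a representation of the Coxeter group. -/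
theorem exists_monoidHom_simple (hM : IsRightAngled M) (h2 : (2 : K) ≠ 0) (a b d : B → K)
    (hd0 : ∀ i, d i ≠ 0) (hd : ∀ i, d i * d i = a i * a i + 4 * b i) (g : B → A)
    (hg : ∀ i, g i * g i = a i • g i + b i • 1)
    (hcomm : ∀ i j, i ≠ j → M i j = 2 → Commute (g i) (g j)) :
    ∃ φ : W →* A, ∀ i, g i = (d i / 2) • φ (cs.simple i) + (a i / 2) • 1 := by
  let f : B → A := fun i => (d i)⁻¹ • ((2 : K) • g i - a i • 1)
  have hsq : ∀ i, f i * f i = 1 := by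
    intro i
    simp only [f, smul_mul_smul_comm]
    -- Completing the square: `(2g - a)² = 4(g² - a g) + a² = 4b + a²`.
    have e : ((2 : K) • g i - a i • (1 : A)) * ((2 : K) • g i - a i • 1) = (d i * d i) • 1 := by
      rw [hd, sub_mul, mul_sub, mul_sub, smul_mul_smul_comm, hg]
      simp only [smul_mul_assoc, mul_smul_comm, one_mul, mul_one]
      module
    rw [e, smul_smul, ← mul_inv, inv_mul_cancel₀ (mul_ne_zero (hd0 i) (hd0 i)), one_smul]
  have hf : M.IsLiftable f := by
    intro i j
    by_cases hij : i = j
    · subst hij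
      rw [M.diagonal, pow_one, hsq]
    rcases hM i j with h | h | h
    · exact absurd h (M.off_diagonal i j hij)
    · have hc : Commute (f i) (f j) := by
        refine Commute.smul_left (Commute.smul_right ?_ _) _
        refine Commute.sub_left (Commute.sub_right ?_ ?_) ?_
        · exact ((hcomm i j hij h).smul_left _).smul_right _
        · exact (Commute.one_right _).smul_right _
        · exact (Commute.one_left _).smul_left _
      rw [h, hc.mul_pow, pow_two, pow_two, hsq, hsq, one_mul]
    · rw [h, pow_zero]
  refine ⟨cs.lift ⟨f, hf⟩, fun i => ?_⟩
  rw [cs.lift_apply_simple]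
  simp only [f, smul_smul]
  rw [show d i / 2 * (d i)⁻¹ = 1 / 2 by field_simp [hd0 i], smul_sub, smul_smul, smul_smul,
    show (1 / 2 : K) * 2 = 1 by field_simp]
  module

-- When the product of the factors `p_i φ(s_i) + q_i` is expanded, every choice of some `q_i` drops
-- a letter. The bound is the length of the word, which need not be reduced.
open Submodule in
theorem prod_sub_smul_mem_span (φ : W →* A) (p q : B → K) (g : B → A)
    (hg : ∀ i, g i = p i • φ (cs.simple i) + q i • 1) (ω : List B) :
    (ω.map g).prod - (ω.map p).prod • φ (cs.wordProd ω) ∈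
      span K (φ '' {v | cs.length v < ω.length}) := by
  induction ω with
  | nil => simp
  | cons i ω ih =>
    set z := (ω.map g).prod - (ω.map p).prod • φ (cs.wordProd ω) with hz
    have hz' : (ω.map g).prod = (ω.map p).prod • φ (cs.wordProd ω) + z := by rw [hz]; abel
    have e : ((i :: ω).map g).prod - ((i :: ω).map p).prod • φ (cs.wordProd (i :: ω)) =
        p i • (φ (cs.simple i) * z) + q i • z +
          (q i * (ω.map p).prod) • φ (cs.wordProd ω) := by
      rw [List.map_cons, List.prod_cons, List.map_cons, List.prod_cons, cs.wordProd_cons, map_mul,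
        hz', hg, add_mul, mul_add, mul_add]
      simp only [smul_mul_assoc, mul_smul_comm, one_mul]
      module
    have hmono : span K (φ '' {v | cs.length v < ω.length}) ≤
        span K (φ '' {v | cs.length v < (i :: ω).length}) :=
      span_mono (Set.image_mono fun v hv => Nat.lt_succ_of_lt hv)
    have hmul : span K (φ '' {v | cs.length v < ω.length}) ≤
        (span K (φ '' {v | cs.length v < (i :: ω).length})).comap
          (LinearMap.mulLeft K (φ (cs.simple i))) := by
      rw [span_le]
      rintro _ ⟨v, hv, rfl⟩
      rw [SetLike.mem_coe, mem_comap, LinearMap.mulLeft_apply, ← map_mul]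
      refine subset_span ⟨_, ?_, rfl⟩
      have := cs.length_simple_mul v i
      simp only [Set.mem_ofPred_eq, List.length_cons] at hv ⊢
      omega
    rw [e]
    refine add_mem (add_mem (smul_mem _ _ (hmul ih)) (smul_mem _ _ (hmono ih)))
      (smul_mem _ _ (subset_span ⟨_, ?_, rfl⟩))
    have := cs.length_wordProd_le ω
    simp only [Set.mem_ofPred_eq, List.length_cons]
    omega

end Deformation

section MinLength

variable {B W : Type*} [Group W] {M : CoxeterMatrix B} (cs : CoxeterSystem M W)

theorem exists_isMinLength (O : ConjClasses W) : ∃ w, ConjClasses.mk w = O ∧ IsMinLength cs w := by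
  obtain ⟨v, rfl⟩ := ConjClasses.exists_rep O
  obtain ⟨w, hw, hmin⟩ := (measure cs.length).wf.has_min {w | IsConj v w} ⟨v, IsConj.refl v⟩
  exact ⟨w, ConjClasses.mk_eq_mk_iff_isConj.2 hw.symm,
    fun u hu => not_lt.1 (hmin u (hw.trans hu))⟩

end MinLength

end GenericHecke

/-! ### Comparison of the two bases. -/

open GenericHecke in
theorem mainTheorem4 {B W K : Type*} [Group W] {M : CoxeterMatrix B} (cs : CoxeterSystem M W)
    (hM : IsRightAngled M) [Field K] [IsAlgClosed K] (hK : ringChar K ≠ 2) (a b : B → K)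
    (hab : ∀ s : B, b s ≠ -((a s) ^ 2 / 4)) :
    ∃ β : Module.Basis (ConjClasses W) K (Cocentre K (heckeAlgebra cs a b)),
      ∀ (O : ConjClasses W) (w : W), ConjClasses.mk w = O → IsMinLength cs w →
        β O = (commutatorSubspace K (heckeAlgebra cs a b)).mkQ (T cs a b w) := by
  have h2 : (2 : K) ≠ 0 := Ring.two_ne_zero hK
  have h4 : (4 : K) ≠ 0 := by rw [show (4 : K) = 2 * 2 by norm_num]; exact mul_ne_zero h2 h2
  have hci := conjInvariant_of_isRightAngled hM cs a b
  -- A square root of the discriminant of `X² - a_i X - b_i`; it vanishes only if `b_i = -a_i²/4`.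
  choose d hd using fun i => IsAlgClosed.exists_pow_nat_eq (a i * a i + 4 * b i) zero_lt_two
  simp only [pow_two] at hd
  have hd0 : ∀ i, d i ≠ 0 := by
    intro i h0
    have h1 := hd i
    rw [h0, zero_mul] at h1
    apply hab i
    field_simp
    linear_combination -h1
  obtain ⟨φ, hφ⟩ := exists_monoidHom_simple cs hM h2 a b d hd0 hd (gen cs a b) (gen_mul_self hci)
    fun i j => gen_commute hM
  choose ω hω using cs.exists_isReduced
  let c : W → K := fun w => ((ω w).map fun i => d i / 2).prod
  have hc : ∀ w, c w ≠ 0 := by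
    intro w h0
    obtain ⟨i, -, hi⟩ := List.mem_map.1 (List.prod_eq_zero_iff.1 h0)
    exact div_ne_zero (hd0 i) h2 hi
  have hT : ∀ w, T cs a b w - c w • φ w ∈
      Submodule.span K (φ '' {v | cs.length v < cs.length w}) := by
    intro w
    have h1 := prod_sub_smul_mem_span cs φ (fun i => d i / 2) (fun i => a i / 2) (gen cs a b) hφ
      (ω w)
    rwa [← T_eq_of_isReduced hci (hω w).1, ← (hω w).1.eq, ← (hω w).2] at h1
  obtain ⟨βT, hβT⟩ := T_basis hci
  obtain ⟨βφ, hβφ⟩ := exists_basis_of_triangular' βT φ cs.length c hc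
    fun w => by rw [hβT]; exact hT w
  obtain ⟨γ, hγ⟩ := exists_basis_cocentre φ βφ hβφ
  choose m hm hmin using exists_isMinLength cs
  obtain ⟨β, hβ⟩ := exists_basis_of_triangular γ
    (fun O => (commutatorSubspace K (heckeAlgebra cs a b)).mkQ (T cs a b (m O)))
    (fun O => cs.length (m O)) (fun O => c (m O)) (fun O => hc _) (by
      intro O
      -- The class of a `v` shorter than `m O` has a minimal length at most `ℓ(v)`, hence smaller
      -- rank than `O`. So lower terms in `W` stay lower terms among conjugacy classes.
      have h1 : Submodule.span K (φ '' {v | cs.length v < cs.length (m O)}) ≤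
          (Submodule.span K (γ '' {P | cs.length (m P) < cs.length (m O)})).comap
            (commutatorSubspace K (heckeAlgebra cs a b)).mkQ := by
        rw [Submodule.span_le]
        rintro _ ⟨v, hv, rfl⟩
        rw [SetLike.mem_coe, Submodule.mem_comap, ← hγ]
        refine Submodule.subset_span ⟨_, ?_, rfl⟩
        exact lt_of_le_of_lt (hmin _ _ (ConjClasses.mk_eq_mk_iff_isConj.1 (hm _))) hv
      have h3 := h1 (hT (m O))
      rw [Submodule.mem_comap, map_sub, map_smul, ← hγ, hm] at h3
      exact h3)
  refine ⟨β, fun O w hw hwm => ?_⟩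
  rw [hβ]
  exact cs.eq_of_isMinLength hM
    (fun v => (commutatorSubspace K (heckeAlgebra cs a b)).mkQ (T cs a b v)) (mkQ_T_conj_simple hci) (hmin O) hwm
    (ConjClasses.mk_eq_mk_iff_isConj.1 ((hm O).trans hw.symm))
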